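/- Consider a system of $n$ qubits with Hilbert space dimension $d=2^n$, a monitored Clifford circuit on it with $\tau$ rounds, and a subsystem $A$ of $n_A$ of the qubits with complement $B$. In round $j=1,\dots,\tau$ a Hermitian Pauli operator $P_j'$ (a tensor product of $I,X,Y,Z$ up to sign) is measured projectively, with outcome $m_j=\pm1$ and projector $\frac{I+m_jP_j'}{2}$, and then a Clifford unitary $U_j$ (a unitary that conjugates Pauli operators to Pauli operators) is applied. For a record $m=(m_1,\dots,m_\tau)$ put $$K(m)=U_\tau\frac{I+m_\tau P_\tau'}{2}\cdots U_1\frac{I+m_1P_1'}{2},\qquad \mathrm{Prob}(m)=\frac1d\operatorname{Tr}\big[K(m)^\dagger K(m)\big].$$ If $\mathrm{Prob}(m)\neq0$, the output state is $$|\Psi(m)\rangle=\mathrm{Prob}(m)^{-1/2}\,(K(m)\otimes I_R)\,\frac{1}{\sqrt d}\sum_{x}|x\rangle|x\rangle_R,$$ where $R$ is a reference system of $n$ qubits. Let $\rho_{AB}(m)$ and $\rho_B(m)$ be its reduced density matrices on $AB$ and $B$, and let $S_{A|B}(m)=S(\rho_{AB}(m))-S(\rho_B(m))$ with $S(\rho)=-\operatorname{Tr}\rho\log_2\rho$.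 Let $P_j=(U_\tau\cdots U_j)P_j'(U_\tau\cdots U_j)^\dagger$. For a Pauli operator $P_A$ supported on $A$, let $C(P_A)\in\{\pm1\}^\tau$ be the codeword vector with $P_AP_j=C(P_A)_j\,P_jP_A$. Let $E(P_i)\in\{\pm1\}^\tau$ be the error vector with $E(P_i)_j=1$ for $j>i$ and $P_iP_j=E(P_i)_j\,P_jP_i$ for $j\le i$, and let $\mathcal E\subseteq\{\pm1\}^\tau$ be the group generated by $E(P_1),\dots,E(P_\tau)$ under componentwise multiplication. Let $N_{I_A}$ be the number of Pauli operators $P_A$ on $A$, counted modulo phases (so that there are $4^{n_A}$ of them in total), with $C(P_A)\in\mathcal E$. Then for every record $m$ with $\mathrm{Prob}(m)\neq0$ $$S_{A|B}(m)=-n_A+\log_2N_{I_A}.$$ In particular, the value of $S_{A|B}(m)$ is the same for all records $m$ with $\mathrm{Prob}(m)\neq0$. -/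

import Mathlib

open scoped Matrix Kronecker

namespace MonitoredClifford

/-- The four single-qubit Pauli labels. -/
inductive Pauli where
  | I | X | Y | Z
  deriving DecidableEq

instance : Fintype Pauli where
  elems := {.I, .X, .Y, .Z}
  complete := by intro x; cases x <;> simp

/-- The single-qubit Pauli matrices. -/
noncomputable def Pauli.toMatrix : Pauli → Matrix (Fin 2) (Fin 2) ℂ
  | .I => 1
  | .X => !![0, 1; 1, 0]
  | .Y => !![0, -Complex.I; Complex.I, 0]
  | .Z => !![1, 0; 0, -1]

/-- Computational basis labels of a system of qubits sitting at the sites `ι`. -/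
abbrev Qubits (ι : Type) : Type := ι → Fin 2

/-- Operators on `n` qubits, as matrices in the computational basis (dimension `d = 2 ^ n`). -/
abbrev Operator (n : ℕ) : Type := Matrix (Qubits (Fin n)) (Qubits (Fin n)) ℂ

/-- Pauli operators on `n` qubits modulo phases, given by a Pauli label at every site. -/
abbrev PauliString (n : ℕ) : Type := Fin n → Pauli

/-- The operator `σ_{p 1} ⊗ ⋯ ⊗ σ_{p n}`. -/
noncomputable def PauliString.toOperator {n : ℕ} (p : PauliString n) : Operator n :=
  Matrix.of fun x y => ∏ i, (p i).toMatrix (x i) (y i)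

/-- `p` acts trivially outside the set of qubits `A`; there are `4 ^ |A|` such strings. -/
def PauliString.SupportedOn {n : ℕ} (p : PauliString n) (A : Finset (Fin n)) : Prop :=
  ∀ i, i ∉ A → p i = Pauli.I

/-- Elements of the Pauli group: Pauli strings times one of the phases `1, i, -1, -i`. -/
def IsPauli {n : ℕ} (M : Operator n) : Prop :=
  ∃ (k : ℕ) (p : PauliString n), M = Complex.I ^ k • p.toOperator

/-- Clifford unitaries: unitaries that transform Pauli operators into Pauli operators. -/
def IsClifford {n : ℕ} (U : Operator n) : Prop :=
  U ∈ Matrix.unitaryGroup (Qubits (Fin n)) ℂ ∧ ∀ M : Operator n, IsPauli M → IsPauli (U * M * Uᴴ)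

/-- A monitored Clifford circuit on `n` qubits with `τ` rounds. In round `j` the Hermitian Pauli
operator `P' j` is measured projectively, and then the Clifford unitary `U j` is applied. -/
structure Circuit (n τ : ℕ) where
  P' : Fin τ → Operator n
  U : Fin τ → Operator n
  isPauli : ∀ j, IsPauli (P' j)
  isHermitian : ∀ j, (P' j).IsHermitian
  isClifford : ∀ j, IsClifford (U j)

/-- The sign `1` if `M` and `N` commute and `-1` otherwise. It is used for Pauli operators only,
and these either commute or anticommute. -/
noncomputable def commSign {n : ℕ} (M N : Operator n) : ℤˣ :=
  open Classical in if M * N = N * M then 1 else -1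

/-- The projector `(I + m P) / 2` onto the measurement outcome `m = ±1`. -/
noncomputable def proj {n : ℕ} (P : Operator n) (m : ℤˣ) : Operator n :=
  (1 / 2 : ℂ) • (1 + ((m : ℤ) : ℂ) • P)

namespace Circuit

variable {n τ : ℕ} (c : Circuit n τ)

/-- The product `U_τ ⋯ U_j`. -/
noncomputable def evolution (j : Fin τ) : Operator n :=
  ((List.ofFn c.U).drop j).reverse.prod

/-- The time-evolved measured Pauli operator `P_j = (U_τ ⋯ U_j) P'_j (U_τ ⋯ U_j)†`. -/
noncomputable def P (j : Fin τ) : Operator n :=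
  c.evolution j * c.P' j * (c.evolution j)ᴴ

/-- The codeword vector `C(Q)`, recording the commutation relations of `Q` with all `P_j`. -/
noncomputable def codeword (Q : Operator n) : Fin τ → ℤˣ :=
  fun j => commSign Q (c.P j)

/-- The error vector `E(P_i)`, recording the commutation relations of `P_i` with the `P_j` in the
past only. -/
noncomputable def errorVector (i : Fin τ) : Fin τ → ℤˣ :=
  fun j => if i < j then 1 else commSign (c.P i) (c.P j)

/-- The group generated by the error vectors under componentwise multiplication. -/
noncomputable def errorGroup : Subgroup (Fin τ → ℤˣ) :=
  Subgroup.closure (Set.range c.errorVector)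

/-- `N_{I_A}`: the number of Pauli operators on `A` (modulo phases) whose codeword vector lies in
the error group. -/
noncomputable def numNull (A : Finset (Fin n)) : ℕ :=
  Set.ncard {p : PauliString n | p.SupportedOn A ∧ c.codeword p.toOperator ∈ c.errorGroup}

/-- The (unnormalized) operation implemented by the circuit when the measurement record is `m`:
`U_τ Π'_τ(m_τ) ⋯ U_1 Π'_1(m_1)`. -/
noncomputable def kraus (m : Fin τ → ℤˣ) : Operator n :=
  (List.ofFn fun j => c.U j * proj (c.P' j) (m j)).reverse.prod

/-- The probability `Tr[K(m)† K(m)] / d` of the record `m` on the maximally mixed initial state. -/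
noncomputable def prob (m : Fin τ → ℤˣ) : ℝ :=
  (((c.kraus m)ᴴ * c.kraus m).trace).re / 2 ^ n

end Circuit

/-- The state `d^{-1/2} ∑ₓ |x⟩|x⟩`, maximally entangled between the system and a reference `R` of
`n` qubits. -/
noncomputable def epr (n : ℕ) : Qubits (Fin n) × Qubits (Fin n) → ℂ :=
  fun x => if x.1 = x.2 then (((Real.sqrt (2 ^ n))⁻¹ : ℝ) : ℂ) else 0

/-- The partial trace over the first tensor factor. -/
def traceLeft {X Y : Type} [Fintype X] (ρ : Matrix (X × Y) (X × Y) ℂ) : Matrix Y Y ℂ :=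
  Matrix.of fun y y' => ∑ x, ρ (x, y) (x, y')

/-- The partial trace over the second tensor factor. -/
def traceRight {X Y : Type} [Fintype Y] (ρ : Matrix (X × Y) (X × Y) ℂ) : Matrix X X ℂ :=
  Matrix.of fun x x' => ∑ y, ρ (x, y) (x', y)

theorem isHermitian_traceLeft {X Y : Type} [Fintype X] {ρ : Matrix (X × Y) (X × Y) ℂ}
    (h : ρ.IsHermitian) : (traceLeft ρ).IsHermitian := by
  ext y y'
  simp only [traceLeft, Matrix.conjTranspose_apply, Matrix.of_apply, star_sum]
  exact Finset.sum_congr rfl fun x _ => h.apply _ _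

theorem isHermitian_traceRight {X Y : Type} [Fintype Y] {ρ : Matrix (X × Y) (X × Y) ℂ}
    (h : ρ.IsHermitian) : (traceRight ρ).IsHermitian := by
  ext y y'
  simp only [traceRight, Matrix.conjTranspose_apply, Matrix.of_apply, star_sum]
  exact Finset.sum_congr rfl fun x _ => h.apply _ _

/-- The von Neumann entropy `-Tr ρ log₂ ρ` in bits. -/
noncomputable def entropy {X : Type} [Fintype X] [DecidableEq X] {ρ : Matrix X X ℂ}
    (hρ : ρ.IsHermitian) : ℝ :=
  -∑ i, hρ.eigenvalues i * Real.logb 2 (hρ.eigenvalues i)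

/-- The splitting of the `n` qubits into those of `A` and those of the complement `B`. -/
def splitAB {n : ℕ} (A : Finset (Fin n)) :
    Qubits (Fin n) ≃ Qubits {i // i ∈ A} × Qubits {i // i ∉ A} :=
  Equiv.piEquivPiSubtypeProd (fun i => i ∈ A) (fun _ => Fin 2)

namespace Circuit

variable {n τ : ℕ} (c : Circuit n τ)

/-- The output state `|Ψ(m)⟩ = Prob(m)^{-1/2} (K(m) ⊗ I_R) |EPR⟩` on the system and the reference;
it is meant for records `m` of nonzero probability. -/
noncomputable def outputState (m : Fin τ → ℤˣ) : Qubits (Fin n) × Qubits (Fin n) → ℂ :=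
  (((Real.sqrt (c.prob m))⁻¹ : ℝ) : ℂ) • ((c.kraus m ⊗ₖ (1 : Operator n)) *ᵥ epr n)

/-- The density matrix `ρ_{AB} = Tr_R |Ψ(m)⟩⟨Ψ(m)|`. -/
noncomputable def rhoAB (m : Fin τ → ℤˣ) : Operator n :=
  traceRight (Matrix.vecMulVec (c.outputState m) (star (c.outputState m)))

/-- The reduced density matrix `ρ_B = Tr_A ρ_{AB}` on the complement `B` of `A`. -/
noncomputable def rhoB (A : Finset (Fin n)) (m : Fin τ → ℤˣ) :
    Matrix (Qubits {i // i ∉ A}) (Qubits {i // i ∉ A}) ℂ :=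
  traceLeft (Matrix.reindex (splitAB A) (splitAB A) (c.rhoAB m))

theorem isHermitian_rhoAB (m : Fin τ → ℤˣ) : (c.rhoAB m).IsHermitian :=
  isHermitian_traceRight (by
    ext x y
    simp [Matrix.vecMulVec_apply, mul_comm])

theorem isHermitian_rhoB (A : Finset (Fin n)) (m : Fin τ → ℤˣ) : (c.rhoB A m).IsHermitian :=
  isHermitian_traceLeft ((c.isHermitian_rhoAB m).submatrix _)

/-- The conditional entropy `S_{A|B}(m) = S_{AB}(m) - S_B(m)`. -/
noncomputable def condEntropy (A : Finset (Fin n)) (m : Fin τ → ℤˣ) : ℝ :=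
  entropy (c.isHermitian_rhoAB m) - entropy (c.isHermitian_rhoB A m)

end Circuit

end MonitoredClifford

/-!
The unitaries can be moved to the beginning of the circuit (`Circuit.kraus_eq`): `K(m)` is the
product of the projectors `(1 + m_j P_j) / 2` of the time-evolved Pauli operators times a unitary,
which acts trivially on the maximally mixed state. So `ρ_{AB}` is the normalization of `M = K K†`,
where only the operators `P_j` enter.

Everything rests on a dichotomy (`projProd_spec`), proved by induction on the number of
measurements. The operator `M` is a multiple of a projector, and a Pauli operator `Q` commutes with
`M` if `C(Q) ∈ ℰ`, whereas `M Q M = 0` if `C(Q) ∉ ℰ`. Indeed, after a further measurement of `p` the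
operator `Q` commutes with the new `M` exactly if it commutes with `p` and one of `Q`, `Q p`
commutes with the old `M`; the group `ℰ` obeys the same recursion (`mem_seqErrorGroup_succ`),
because the last error vector is the codeword of `p` with respect to the earlier measurements.

The reduced state on `B` is reached through the twirl `T = ∑ P_A M P_A` over the Pauli operators on
`A`, which equals `2 ^ n_A • (1 ⊗ Tr_A M)` (`reindex_twirl`). If `M² = l M`, the dichotomy gives
`T² = l N_{I_A} T` (`twirl_mul_self`), for each `P_A` is matched with `N_{I_A}` operators `P_A'` such
that `C(P_A P_A') ∈ ℰ`. Hence `ρ_{AB}` and `ρ_B` both have flat spectra, with nonzero eigenvalues `μ`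
and `μ N_{I_A} / 2 ^ n_A`, and their entropies are `-log₂` of these (`entropy_of_mul_self`). The
unknown `μ` cancels in the difference. No stabilizer group and no dimension count is needed.
-/

namespace MonitoredClifford

/-! ### Tensor products of single-qubit matrices -/

/-- The operator `f 0 ⊗ ⋯ ⊗ f (n - 1)` on `n` qubits. -/
def tensor {n : ℕ} (f : Fin n → Matrix (Fin 2) (Fin 2) ℂ) : Operator n :=
  Matrix.of fun x y => ∏ i, f i (x i) (y i)

theorem tensor_mul {n : ℕ} (f g : Fin n → Matrix (Fin 2) (Fin 2) ℂ) :
    tensor f * tensor g = tensor fun i => f i * g i := by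
  ext x y
  simp only [tensor, Matrix.mul_apply, Matrix.of_apply, Finset.prod_univ_sum,
    Fintype.piFinset_univ, Finset.prod_mul_distrib]

theorem tensor_one {n : ℕ} : tensor (fun _ : Fin n => 1) = 1 := by
  ext x y
  simp [tensor, Matrix.one_apply, Finset.prod_ite_zero, funext_iff]

theorem tensor_smul {n : ℕ} (a : Fin n → ℂ) (f : Fin n → Matrix (Fin 2) (Fin 2) ℂ) :
    (tensor fun i => a i • f i) = (∏ i, a i) • tensor f := by
  ext x y
  simp [tensor, Finset.prod_mul_distrib]

theorem tensor_conjTranspose {n : ℕ} (f : Fin n → Matrix (Fin 2) (Fin 2) ℂ) :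
    (tensor f)ᴴ = tensor fun i => (f i)ᴴ := by
  ext x y
  simp [tensor]

theorem eq_zero_of_eq_neg {n : ℕ} {M : Operator n} (h : M = -M) : M = 0 := by
  ext x y
  exact CharZero.eq_neg_self_iff.mp (congrFun (congrFun h x) y)

/-! ### The Pauli group -/

/-- Multiplication of Pauli labels modulo phases, the Klein four-group. -/
def Pauli.mul : Pauli → Pauli → Pauli
  | .I, q => q
  | p, .I => p
  | .X, .X => .I
  | .Y, .Y => .I
  | .Z, .Z => .I
  | .X, .Y => .Z
  | .Y, .X => .Z
  | .X, .Z => .Y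
  | .Z, .X => .Y
  | .Y, .Z => .X
  | .Z, .Y => .X

instance : Mul Pauli := ⟨Pauli.mul⟩

theorem Pauli.mul_def (p q : Pauli) : p * q = p.mul q := rfl

theorem Pauli.mul_mul_cancel (p q : Pauli) : p * (p * q) = q := by
  revert p q; decide

theorem Pauli.conjTranspose_toMatrix (p : Pauli) : p.toMatrixᴴ = p.toMatrix := by
  cases p <;> ext i j <;> fin_cases i <;> fin_cases j <;> simp [Pauli.toMatrix]

theorem Pauli.toMatrix_mul_self (p : Pauli) : p.toMatrix * p.toMatrix = 1 := by
  cases p <;> ext i j <;> fin_cases i <;> fin_cases j <;>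
    simp [Pauli.toMatrix, Matrix.mul_apply]

theorem Pauli.toMatrix_mul (p q : Pauli) :
    ∃ k : ℕ, p.toMatrix * q.toMatrix = Complex.I ^ k • (p * q).toMatrix := by
  cases p <;> cases q <;> solve
    | (refine ⟨0, ?_⟩
       ext i j
       fin_cases i <;> fin_cases j <;>
         simp [Pauli.toMatrix, Matrix.mul_apply, Pauli.mul_def, Pauli.mul])
    | (refine ⟨1, ?_⟩
       ext i j
       fin_cases i <;> fin_cases j <;>
         simp [Pauli.toMatrix, Matrix.mul_apply, Pauli.mul_def, Pauli.mul])
    | (refine ⟨3, ?_⟩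
       ext i j
       fin_cases i <;> fin_cases j <;>
         simp [Pauli.toMatrix, Matrix.mul_apply, Pauli.mul_def, Pauli.mul, Complex.I_pow_three])

theorem Pauli.toMatrix_comm (p q : Pauli) :
    ∃ s : ℤˣ, p.toMatrix * q.toMatrix = ((s : ℤ) : ℂ) • (q.toMatrix * p.toMatrix) := by
  cases p <;> cases q <;> solve
    | (refine ⟨1, ?_⟩
       ext i j
       fin_cases i <;> fin_cases j <;> simp [Pauli.toMatrix, Matrix.mul_apply])
    | (refine ⟨-1, ?_⟩
       ext i j
       fin_cases i <;> fin_cases j <;> simp [Pauli.toMatrix, Matrix.mul_apply])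

/-- The single-qubit depolarizing identity. -/
theorem Pauli.sum_toMatrix_mul (x u y v : Fin 2) :
    ∑ p : Pauli, p.toMatrix x u * p.toMatrix v y
      = 2 * ((if x = y then 1 else 0) * if u = v then 1 else 0) := by
  have h : (Finset.univ : Finset Pauli) = {.I, .X, .Y, .Z} := rfl
  rw [h]
  fin_cases x <;> fin_cases u <;> fin_cases y <;> fin_cases v <;>
    simp [Pauli.toMatrix] <;> norm_num

theorem PauliString.toOperator_eq_tensor {n : ℕ} (p : PauliString n) :
    p.toOperator = tensor fun i => (p i).toMatrix := rfl

theorem PauliString.conjTranspose_toOperator {n : ℕ} (p : PauliString n) :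
    p.toOperatorᴴ = p.toOperator := by
  simp [toOperator_eq_tensor, tensor_conjTranspose, Pauli.conjTranspose_toMatrix]

theorem PauliString.toOperator_mul_self {n : ℕ} (p : PauliString n) :
    p.toOperator * p.toOperator = 1 := by
  simp [toOperator_eq_tensor, tensor_mul, Pauli.toMatrix_mul_self, tensor_one]

theorem PauliString.toOperator_mul {n : ℕ} (p q : PauliString n) :
    ∃ k : ℕ, p.toOperator * q.toOperator = Complex.I ^ k • (p * q).toOperator := by
  choose k hk using fun i => Pauli.toMatrix_mul (p i) (q i)
  refine ⟨∑ i, k i, ?_⟩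
  simp only [toOperator_eq_tensor, tensor_mul, hk, tensor_smul, Finset.prod_pow_eq_pow_sum]
  rfl

theorem PauliString.toOperator_comm {n : ℕ} (p q : PauliString n) :
    ∃ s : ℤˣ, p.toOperator * q.toOperator
      = ((s : ℤ) : ℂ) • (q.toOperator * p.toOperator) := by
  choose s hs using fun i => Pauli.toMatrix_comm (p i) (q i)
  refine ⟨∏ i, s i, ?_⟩
  simp only [toOperator_eq_tensor, tensor_mul, hs, tensor_smul]
  push_cast
  rfl

theorem PauliString.isPauli {n : ℕ} (p : PauliString n) : IsPauli p.toOperator :=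
  ⟨0, p, by simp⟩

namespace IsPauli

variable {n : ℕ} {M N Q : Operator n}

theorem mul (hM : IsPauli M) (hN : IsPauli N) : IsPauli (M * N) := by
  obtain ⟨k, p, rfl⟩ := hM
  obtain ⟨l, q, rfl⟩ := hN
  obtain ⟨j, hj⟩ := PauliString.toOperator_mul p q
  refine ⟨k + l + j, p * q, ?_⟩
  rw [smul_mul_smul_comm, hj, smul_smul, pow_add, pow_add]

theorem mul_conjTranspose (hM : IsPauli M) : M * Mᴴ = 1 := by
  obtain ⟨k, p, rfl⟩ := hM
  rw [Matrix.conjTranspose_smul, smul_mul_smul_comm, p.conjTranspose_toOperator,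
    p.toOperator_mul_self, star_pow, ← mul_pow]
  simp

theorem ne_zero (hM : IsPauli M) : M ≠ 0 := by
  rintro rfl
  simpa using hM.mul_conjTranspose

theorem exists_comm (hM : IsPauli M) (hN : IsPauli N) :
    ∃ s : ℤˣ, M * N = ((s : ℤ) : ℂ) • (N * M) := by
  obtain ⟨k, p, rfl⟩ := hM
  obtain ⟨l, q, rfl⟩ := hN
  obtain ⟨s, hs⟩ := PauliString.toOperator_comm p q
  refine ⟨s, ?_⟩
  rw [smul_mul_smul_comm, smul_mul_smul_comm, hs, smul_comm, mul_comm (Complex.I ^ k)]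

/-- The commutation sign of two Pauli operators is determined by the commutation relation. -/
theorem commSign_eq (hM : IsPauli M) (hN : IsPauli N) {s : ℤˣ}
    (h : M * N = ((s : ℤ) : ℂ) • (N * M)) : commSign M N = s := by
  unfold commSign
  rcases Int.units_eq_one_or s with rfl | rfl
  · simp at h
    simp [h]
  · simp at h
    rw [if_neg]
    intro h'
    have h2 : N * M = -(N * M) := h'.symm.trans h
    exact (hN.mul hM).ne_zero (eq_zero_of_eq_neg h2)

theorem mul_eq_commSign_smul (hM : IsPauli M) (hN : IsPauli N) :
    M * N = ((commSign M N : ℤ) : ℂ) • (N * M) := by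
  obtain ⟨s, hs⟩ := hM.exists_comm hN
  rwa [hM.commSign_eq hN hs]

theorem commSign_mul_left (hM : IsPauli M) (hN : IsPauli N) (hQ : IsPauli Q) :
    commSign (M * N) Q = commSign M Q * commSign N Q := by
  refine (hM.mul hN).commSign_eq hQ ?_
  rw [mul_assoc, hN.mul_eq_commSign_smul hQ, Matrix.mul_smul, ← mul_assoc,
    hM.mul_eq_commSign_smul hQ, Matrix.smul_mul, smul_smul, mul_assoc, mul_comm (_ : ℂ)]
  push_cast
  rfl

theorem commSign_smul_left (hM : IsPauli M) (hQ : IsPauli Q) (k : ℕ) :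
    commSign (Complex.I ^ k • M) Q = commSign M Q := by
  refine commSign_eq ?_ hQ ?_
  · obtain ⟨l, p, rfl⟩ := hM
    exact ⟨k + l, p, by rw [smul_smul, pow_add]⟩
  · rw [Matrix.smul_mul, hM.mul_eq_commSign_smul hQ, Matrix.mul_smul, smul_comm]

end IsPauli

/-! ### Projective measurements of Pauli operators -/

section proj

variable {n : ℕ} {P Q M : Operator n}

theorem units_cast_mul_self (m : ℤˣ) : ((m : ℤ) : ℂ) * ((m : ℤ) : ℂ) = 1 := by
  rcases Int.units_eq_one_or m with rfl | rfl <;> simp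

theorem mul_proj (hP : P * P = 1) (m : ℤˣ) : P * proj P m = ((m : ℤ) : ℂ) • proj P m := by
  simp only [proj, Matrix.mul_smul, mul_add, mul_one, hP, smul_add, smul_smul]
  rw [mul_left_comm, units_cast_mul_self, mul_comm (1 / 2 : ℂ), mul_one, add_comm]

theorem proj_mul (hP : P * P = 1) (m : ℤˣ) : proj P m * P = ((m : ℤ) : ℂ) • proj P m := by
  rw [← mul_proj hP]
  simp [proj, mul_add, add_mul]

theorem proj_mul_proj (hP : P * P = 1) (m : ℤˣ) : proj P m * proj P m = proj P m := by
  conv_lhs => enter [1]; rw [proj]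
  rw [Matrix.smul_mul, add_mul, Matrix.smul_mul, mul_proj hP, smul_smul, units_cast_mul_self,
    one_mul, one_smul, ← two_smul ℂ, smul_smul]
  norm_num

theorem conjTranspose_proj (hP : P.IsHermitian) (m : ℤˣ) : (proj P m)ᴴ = proj P m := by
  simp [proj, Matrix.conjTranspose_smul, hP.eq]

theorem commute_proj (h : Commute Q P) (m : ℤˣ) : Commute Q (proj P m) :=
  ((Commute.one_right Q).add_right (h.smul_right _)).smul_right _

/-- An operator anticommuting with `P` exchanges the two eigenspaces of `P`. -/
theorem proj_mul_mul_proj_of_anticommute (hP : P * P = 1) (h : Q * P = -(P * Q)) (m : ℤˣ) :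
    proj P m * Q * proj P m = 0 := by
  have h1 : proj P m * (Q * P) * proj P m = ((m : ℤ) : ℂ) • (proj P m * Q * proj P m) := by
    rw [← mul_assoc, mul_assoc, mul_proj hP, Matrix.mul_smul]
  have h2 : proj P m * (Q * P) * proj P m = -(((m : ℤ) : ℂ) • (proj P m * Q * proj P m)) := by
    rw [h, mul_neg, neg_mul, ← mul_assoc, proj_mul hP, Matrix.smul_mul, Matrix.smul_mul]
  have h3 := eq_zero_of_eq_neg (h1.symm.trans h2)
  refine (smul_eq_zero.mp h3).resolve_left ?_
  rcases Int.units_eq_one_or m with rfl | rfl <;> simp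

/-- Compressing `Q Π` reduces to compressing the two Pauli operators `Q` and `Q P`. -/
theorem mul_mul_proj_mul (m : ℤˣ) :
    M * (Q * proj P m) * M
      = (1 / 2 : ℂ) • (M * Q * M + ((m : ℤ) : ℂ) • (M * (Q * P) * M)) := by
  simp [proj, mul_add, add_mul]

end proj

/-! ### Codewords and errors of a sequence of measured operators -/

section sequence

variable {n τ : ℕ}

/-- The commutation relations of `Q` with the members of the sequence `P`. -/
noncomputable def seqCodeword (P : Fin τ → Operator n) (Q : Operator n) : Fin τ → ℤˣ :=
  fun j => commSign Q (P j)

/-- The commutation relations of `P i` with the members of the sequence `P` that precede it. -/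
noncomputable def seqErrorVector (P : Fin τ → Operator n) (i : Fin τ) : Fin τ → ℤˣ :=
  fun j => if i < j then 1 else commSign (P i) (P j)

/-- The group generated by the error vectors of the sequence `P`. -/
noncomputable def seqErrorGroup (P : Fin τ → Operator n) : Subgroup (Fin τ → ℤˣ) :=
  Subgroup.closure (Set.range (seqErrorVector P))

/-- The product `Π_τ(m_τ) ⋯ Π_1(m_1)` of the projectors onto the outcomes `m` of measuring the
members of the sequence `P`. -/
noncomputable def projProd (P : Fin τ → Operator n) (m : Fin τ → ℤˣ) : Operator n :=
  (List.ofFn fun j => proj (P j) (m j)).reverse.prod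

theorem projProd_succ (P : Fin (τ + 1) → Operator n) (m : Fin (τ + 1) → ℤˣ) :
    projProd P m = proj (P (Fin.last τ)) (m (Fin.last τ)) *
      projProd (fun j => P j.castSucc) (fun j => m j.castSucc) := by
  rw [projProd, List.ofFn_succ', List.concat_eq_append, List.reverse_append]
  rfl

theorem projProd_succ' (P : Fin (τ + 1) → Operator n) (m : Fin (τ + 1) → ℤˣ) :
    projProd P m = projProd (fun j => P j.succ) (fun j => m j.succ) * proj (P 0) (m 0) := by
  simp [projProd, List.ofFn_succ]

theorem seqCodeword_mul {P : Fin τ → Operator n} (hP : ∀ j, IsPauli (P j)) {M N : Operator n}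
    (hM : IsPauli M) (hN : IsPauli N) :
    seqCodeword P (M * N) = seqCodeword P M * seqCodeword P N :=
  funext fun j => hM.commSign_mul_left hN (hP j)

theorem seqCodeword_smul {P : Fin τ → Operator n} (hP : ∀ j, IsPauli (P j)) {M : Operator n}
    (hM : IsPauli M) (k : ℕ) :
    seqCodeword P (Complex.I ^ k • M) = seqCodeword P M :=
  funext fun j => hM.commSign_smul_left (hP j) k

theorem commSign_self (M : Operator n) : commSign M M = 1 := by simp [commSign]

theorem mul_self_signs (v : Fin τ → ℤˣ) : v * v = 1 := by
  ext j; simp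

/-- The error group of a sequence with one more member. All error vectors are trivial at the last
place, and the last member adds the generator given by its codeword with respect to the others.
Signs square to `1`, so this generator occurs at most once. -/
theorem mem_seqErrorGroup_succ (P : Fin (τ + 1) → Operator n) (v : Fin (τ + 1) → ℤˣ) :
    v ∈ seqErrorGroup P ↔ v (Fin.last τ) = 1 ∧
      ((fun j => v j.castSucc) ∈ seqErrorGroup (fun j => P j.castSucc) ∨
        (fun j => v j.castSucc) * seqCodeword (fun j => P j.castSucc) (P (Fin.last τ))
          ∈ seqErrorGroup (fun j => P j.castSucc)) := by
  set P₀ : Fin τ → Operator n := fun j => P j.castSucc with hP₀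
  set w := seqCodeword P₀ (P (Fin.last τ)) with hw
  have hlast : ∀ i, seqErrorVector P i (Fin.last τ) = 1 := fun i => by
    rcases (Fin.le_last i).lt_or_eq with h | rfl
    · simp [seqErrorVector, h]
    · simp [seqErrorVector, commSign_self]
  have hcast : ∀ i : Fin τ,
      (fun j : Fin τ => seqErrorVector P i.castSucc j.castSucc) = seqErrorVector P₀ i :=
    fun i => by
      funext j
      simp [seqErrorVector, hP₀]
  have hw' : (fun j : Fin τ => seqErrorVector P (Fin.last τ) j.castSucc) = w := by
    funext j
    simp [seqErrorVector, hw, hP₀, seqCodeword, Fin.not_lt.mpr (Fin.le_last _)]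
  constructor
  · intro hv
    induction hv using Subgroup.closure_induction with
    | mem x hx =>
      obtain ⟨i, rfl⟩ := hx
      refine ⟨hlast i, ?_⟩
      induction i using Fin.lastCases with
      | last =>
        right
        rw [hw', mul_self_signs]
        exact one_mem _
      | cast i =>
        left
        rw [hcast]
        exact Subgroup.subset_closure ⟨i, rfl⟩
    | one => exact ⟨rfl, Or.inl (one_mem _)⟩
    | mul x y _ _ hx hy =>
      refine ⟨by simp [hx.1, hy.1], ?_⟩
      have e : (fun j : Fin τ => (x * y) j.castSucc)
        = (fun j : Fin τ => x j.castSucc) * fun j : Fin τ => y j.castSucc := rfl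
      rw [e]
      rcases hx.2 with h | h <;> rcases hy.2 with h' | h'
      · exact Or.inl (mul_mem h h')
      · exact Or.inr (by rw [mul_assoc]; exact mul_mem h h')
      · exact Or.inr (by rw [mul_right_comm]; exact mul_mem h h')
      · refine Or.inl ?_
        have := mul_mem h h'
        rwa [mul_mul_mul_comm, mul_self_signs, mul_one] at this
    | inv x _ hx =>
      have e : x⁻¹ = x := by
        rw [inv_eq_iff_mul_eq_one]; exact mul_self_signs x
      rwa [e]
  · rintro ⟨h1, h2⟩
    -- errors of the shorter sequence, continued by `1`, are errors of the longer one
    have ext_mem : ∀ u ∈ seqErrorGroup P₀, (Fin.snoc u 1 : Fin (τ + 1) → ℤˣ) ∈ seqErrorGroup P := by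
      intro u hu
      induction hu using Subgroup.closure_induction with
      | mem x hx =>
        obtain ⟨i, rfl⟩ := hx
        refine Subgroup.subset_closure ⟨i.castSucc, ?_⟩
        rw [← hcast, ← hlast i.castSucc]
        exact (Fin.snoc_init_self _).symm
      | one =>
        convert (one_mem _ : (1 : Fin (τ + 1) → ℤˣ) ∈ seqErrorGroup P)
        funext j
        induction j using Fin.lastCases <;> simp
      | mul x y _ _ hx hy =>
        convert mul_mem hx hy
        funext j
        induction j using Fin.lastCases <;> simp
      | inv x _ hx =>
        have e : x⁻¹ = x := by
          rw [inv_eq_iff_mul_eq_one]; exact mul_self_signs x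
        rwa [e]
    rcases h2 with h2 | h2
    · convert ext_mem _ h2
      funext j
      induction j using Fin.lastCases <;> simp [h1]
    · have h3 : seqErrorVector P (Fin.last τ) ∈ seqErrorGroup P :=
        Subgroup.subset_closure ⟨_, rfl⟩
      convert mul_mem (ext_mem _ h2) h3
      funext j
      induction j using Fin.lastCases with
      | last => simp [h1, hlast]
      | cast j =>
        have e := congrFun hw' j
        change seqErrorVector P (Fin.last τ) j.castSucc = _ at e
        simp [e, mul_assoc]

/-- The record operator `K K†` of a sequence of Pauli measurements is a multiple of a projector, and
every Pauli operator either commutes with it or is annihilated when compressed by it; the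
error group tells which. -/
theorem projProd_spec (P : Fin τ → Operator n) (hP : ∀ j, IsPauli (P j))
    (hH : ∀ j, (P j).IsHermitian) (m : Fin τ → ℤˣ) {M : Operator n}
    (hM : M = projProd P m * (projProd P m)ᴴ) :
    (∃ l : ℝ, M * M = (l : ℂ) • M) ∧ ∀ Q, IsPauli Q →
      (seqCodeword P Q ∈ seqErrorGroup P → Commute Q M) ∧
      (seqCodeword P Q ∉ seqErrorGroup P → M * Q * M = 0) := by
  induction τ generalizing M with
  | zero =>
    have h1 : M = 1 := by simp [hM, projProd]
    subst h1
    refine ⟨⟨1, by simp⟩, fun Q _ => ⟨fun _ => Commute.one_right Q, fun h => ?_⟩⟩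
    exact absurd (by rw [Subsingleton.elim (seqCodeword P Q) 1]; exact one_mem _) h
  | succ τ ih =>
    obtain ⟨⟨l, hl⟩, hQ⟩ := ih (fun j => P j.castSucc) (fun j => hP _) (fun j => hH _)
      (fun j => m j.castSucc) rfl
    rw [projProd_succ] at hM
    set K := projProd (fun j => P j.castSucc) (fun j => m j.castSucc)
    set R := K * Kᴴ
    set p := P (Fin.last τ) with hp
    set s := m (Fin.last τ)
    set a := proj p s with ha
    have hpH : p.IsHermitian := hH _
    have hpP : IsPauli p := hP _
    have hpp : p * p = 1 := by
      have := hpP.mul_conjTranspose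
      rwa [hpH.eq] at this
    have haa : a * a = a := proj_mul_proj hpp s
    have hpa : Commute p a := commute_proj (Commute.refl p) s
    have hMa : M = a * R * a := by
      rw [hM, Matrix.conjTranspose_mul, conjTranspose_proj hpH]
      simp only [mul_assoc, R, ← ha]
    constructor
    · have hMM : M * M = a * (R * a * R) * a := by
        rw [hMa]
        simp only [mul_assoc]
        rw [← mul_assoc a a, haa]
      by_cases h : seqCodeword (fun j => P j.castSucc) p ∈ seqErrorGroup fun j => P j.castSucc
      · have hR : Commute a R := (commute_proj ((hQ p hpP).1 h).symm s).symm
        refine ⟨l, ?_⟩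
        have : a * (R * a * R) * a = a * (R * R) * a := by
          rw [mul_assoc R, hR.eq]
          simp only [mul_assoc, haa]
        rw [hMM, this, hl, hMa]
        simp
      · refine ⟨1 / 2 * l, ?_⟩
        have h0 := (hQ p hpP).2 h
        have := mul_mul_proj_mul (M := R) (Q := 1) (P := p) s
        simp only [one_mul, mul_one, h0, smul_zero, add_zero] at this
        rw [hMM, this, hl, hMa, smul_smul]
        simp
    · intro Q hQP
      have hmem := mem_seqErrorGroup_succ P (seqCodeword P Q)
      change _ ↔ commSign Q p = 1 ∧ (seqCodeword (fun j => P j.castSucc) Q ∈ _ ∨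
        seqCodeword (fun j => P j.castSucc) Q * seqCodeword (fun j => P j.castSucc) p ∈ _) at hmem
      rw [← seqCodeword_mul (fun j => hP _) hQP hpP] at hmem
      rw [hmem]
      have hcomm := hQP.mul_eq_commSign_smul hpP
      constructor
      · rintro ⟨h1, h2⟩
        have hc : Q * p = p * Q := by simpa [h1] using hcomm
        replace hc : Commute Q p := hc
        rcases h2 with h2 | h2
        · have h3 := (hQ Q hQP).1 h2
          rw [hMa]
          exact ((commute_proj hc s).mul_right h3).mul_right (commute_proj hc s)
        · have h3 := (hQ (Q * p) (hQP.mul hpP)).1 h2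
          have hca : Commute (Q * p) a := (commute_proj hc s).mul_left hpa
          have h4 : Commute (Q * p) M := by
            rw [hMa]; exact (hca.mul_right h3).mul_right hca
          -- on the range of `M` the operator `p` acts as the scalar `s`, so it commutes with `M`
          have hpM : p * M = ((s : ℤ) : ℂ) • M := by
            rw [hMa, ← mul_assoc, ← mul_assoc, mul_proj hpp]; simp [ha]
          have hMp : M * p = ((s : ℤ) : ℂ) • M := by
            rw [hMa, mul_assoc, proj_mul hpp]; simp [ha]
          have h5 : Commute p M := hpM.trans hMp.symm
          have h6 : Q = Q * p * p := by rw [mul_assoc, hpp, mul_one]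
          rw [h6]
          exact h4.mul_left h5
      · intro h
        have hassoc : M * Q * M = a * R * (a * Q * a) * R * a := by
          rw [hMa]; simp only [mul_assoc]
        rcases Int.units_eq_one_or (commSign Q p) with h1 | h1
        · have hc : Q * p = p * Q := by simpa [h1] using hcomm
          replace hc : Commute Q p := hc
          have hca := commute_proj hc s
          rw [hassoc, ← hca.eq, mul_assoc Q, haa]
          simp only [h1, true_and, not_or] at h
          have := mul_mul_proj_mul (M := R) (Q := Q) (P := p) s
          rw [(hQ Q hQP).2 h.1, (hQ (Q * p) (hQP.mul hpP)).2 h.2] at this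
          simp only [smul_zero, add_zero] at this
          rw [mul_assoc a, mul_assoc a, this]
          simp
        · have hanti : Q * p = -(p * Q) := by simpa [h1] using hcomm
          rw [hassoc, proj_mul_mul_proj_of_anticommute hpp hanti]
          simp

end sequence

/-! ### Moving the Clifford unitaries to the beginning of the circuit -/

theorem IsClifford.one {n : ℕ} : IsClifford (1 : Operator n) :=
  ⟨one_mem _, fun M hM => by simpa using hM⟩

theorem IsClifford.mul {n : ℕ} {U V : Operator n} (hU : IsClifford U) (hV : IsClifford V) :
    IsClifford (U * V) := by
  refine ⟨mul_mem hU.1 hV.1, fun M hM => ?_⟩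
  have := hU.2 _ (hV.2 M hM)
  simpa only [Matrix.conjTranspose_mul, mul_assoc] using this

theorem isClifford_reverse_prod {n : ℕ} (l : List (Operator n)) (h : ∀ U ∈ l, IsClifford U) :
    IsClifford l.reverse.prod := by
  induction l with
  | nil => simpa using IsClifford.one
  | cons U l ih =>
    rw [List.reverse_cons, List.prod_append, List.prod_singleton]
    exact (ih fun V hV => h V (List.mem_cons_of_mem _ hV)).mul (h U List.mem_cons_self)

namespace Circuit

variable {n τ : ℕ}

theorem isClifford_evolution (c : Circuit n τ) (j : Fin τ) : IsClifford (c.evolution j) := by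
  refine isClifford_reverse_prod _ fun U hU => ?_
  obtain ⟨i, rfl⟩ := (List.mem_ofFn' _ _).mp (List.mem_of_mem_drop hU)
  exact c.isClifford i

theorem isPauli_P (c : Circuit n τ) (j : Fin τ) : IsPauli (c.P j) :=
  (c.isClifford_evolution j).2 _ (c.isPauli j)

theorem isHermitian_P (c : Circuit n τ) (j : Fin τ) : (c.P j).IsHermitian :=
  Matrix.isHermitian_mul_mul_conjTranspose _ (c.isHermitian j)

/-- The product `U_τ ⋯ U_1` of all unitaries. -/
noncomputable def totalEvolution (c : Circuit n τ) : Operator n :=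
  (List.ofFn c.U).reverse.prod

theorem isClifford_totalEvolution (c : Circuit n τ) : IsClifford c.totalEvolution := by
  refine isClifford_reverse_prod _ fun U hU => ?_
  obtain ⟨i, rfl⟩ := (List.mem_ofFn' _ _).mp hU
  exact c.isClifford i

/-- The circuit without its first round. The operators `P j` of the later rounds stay the same,
since they only depend on the unitaries applied afterwards. -/
def tail (c : Circuit n (τ + 1)) : Circuit n τ where
  P' j := c.P' j.succ
  U j := c.U j.succ
  isPauli j := c.isPauli j.succ
  isHermitian j := c.isHermitian j.succ
  isClifford j := c.isClifford j.succ

theorem tail_P (c : Circuit n (τ + 1)) (j : Fin τ) : c.tail.P j = c.P j.succ := by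
  simp [P, evolution, tail, List.ofFn_succ]

theorem proj_conj {W P : Operator n} (hW : W ∈ Matrix.unitaryGroup (Qubits (Fin n)) ℂ) (m : ℤˣ) :
    W * proj P m = proj (W * P * Wᴴ) m * W := by
  have h : Wᴴ * W = 1 := Matrix.mem_unitaryGroup_iff'.mp hW
  simp [proj, mul_add, add_mul, mul_assoc, h]

/-- Peeling off the first round works since it does not change the later `P j`, while all `U j`
act on its measurement. -/
theorem kraus_eq (c : Circuit n τ) (m : Fin τ → ℤˣ) :
    c.kraus m = projProd c.P m * c.totalEvolution := by
  induction τ with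
  | zero => simp [kraus, projProd, totalEvolution]
  | succ τ ih =>
    have h1 : c.kraus m = c.tail.kraus (fun j => m j.succ) * (c.U 0 * proj (c.P' 0) (m 0)) := by
      simp [kraus, tail, List.ofFn_succ]
    have h2 : c.totalEvolution = c.tail.totalEvolution * c.U 0 := by
      simp [totalEvolution, tail, List.ofFn_succ]
    have h3 : c.evolution 0 = c.totalEvolution := by
      simp [totalEvolution, evolution]
    have h4 : c.tail.P = fun j => c.P j.succ := funext c.tail_P
    rw [h1, ih, projProd_succ', h4, mul_assoc, mul_assoc, ← mul_assoc c.tail.totalEvolution, ← h2,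
      proj_conj c.isClifford_totalEvolution.1, P, h3]

theorem kraus_mul_conjTranspose (c : Circuit n τ) (m : Fin τ → ℤˣ) :
    c.kraus m * (c.kraus m)ᴴ = projProd c.P m * (projProd c.P m)ᴴ := by
  have h : c.totalEvolution * c.totalEvolutionᴴ = 1 :=
    Matrix.mem_unitaryGroup_iff.mp c.isClifford_totalEvolution.1
  rw [kraus_eq, Matrix.conjTranspose_mul, mul_assoc, ← mul_assoc _ c.totalEvolutionᴴ, h, one_mul]

/-! ### The output state -/

open scoped ComplexOrder in
theorem trace_kraus (c : Circuit n τ) (m : Fin τ → ℤˣ) :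
    (c.kraus m * (c.kraus m)ᴴ).trace = ((2 ^ n * c.prob m : ℝ) : ℂ) := by
  have h := (Matrix.posSemidef_conjTranspose_mul_self (c.kraus m)).trace_nonneg
  rw [Matrix.trace_mul_comm, prob, mul_div_cancel₀ _ (by positivity)]
  exact Complex.ext rfl (by simpa using (Complex.nonneg_iff.mp h).2.symm)

open scoped ComplexOrder in
theorem prob_nonneg (c : Circuit n τ) (m : Fin τ → ℤˣ) : 0 ≤ c.prob m := by
  have h := (Matrix.posSemidef_conjTranspose_mul_self (c.kraus m)).trace_nonneg
  exact div_nonneg (Complex.nonneg_iff.mp h).1 (by positivity)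

theorem outputState_apply (c : Circuit n τ) (m : Fin τ → ℤˣ) (x r : Qubits (Fin n)) :
    c.outputState m (x, r)
      = (((Real.sqrt (c.prob m))⁻¹ * (Real.sqrt (2 ^ n))⁻¹ : ℝ) : ℂ) * c.kraus m x r := by
  simp only [outputState, Pi.smul_apply, Matrix.mulVec, dotProduct, Matrix.kroneckerMap_apply,
    epr, Fintype.sum_prod_type, Matrix.one_apply, smul_eq_mul]
  simp
  ring

/-- The state of the system is `K K† / (d Prob)`. -/
theorem rhoAB_eq (c : Circuit n τ) (m : Fin τ → ℤˣ) :
    c.rhoAB m = (((2 ^ n * c.prob m)⁻¹ : ℝ) : ℂ) • (c.kraus m * (c.kraus m)ᴴ) := by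
  have h : (Real.sqrt (c.prob m))⁻¹ * (Real.sqrt (2 ^ n))⁻¹ *
      ((Real.sqrt (c.prob m))⁻¹ * (Real.sqrt (2 ^ n))⁻¹) = (2 ^ n * c.prob m)⁻¹ := by
    rw [mul_mul_mul_comm, ← mul_inv, ← mul_inv, Real.mul_self_sqrt (c.prob_nonneg m),
      Real.mul_self_sqrt (by positivity), mul_inv, mul_comm]
  ext x y
  simp only [rhoAB, traceRight, Matrix.of_apply, Matrix.vecMulVec_apply, Pi.star_apply,
    outputState_apply, Matrix.smul_apply, Matrix.mul_apply, Matrix.conjTranspose_apply,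
    smul_eq_mul, Finset.mul_sum, ← h]
  refine Finset.sum_congr rfl fun r _ => ?_
  rw [star_mul']
  simp only [Complex.star_def, Complex.conj_ofReal]
  push_cast
  ring

end Circuit

/-! ### Entropy of flat spectra -/

theorem trace_traceLeft {X Y : Type} [Fintype X] [Fintype Y] (ρ : Matrix (X × Y) (X × Y) ℂ) :
    (traceLeft ρ).trace = ρ.trace := by
  simp only [Matrix.trace, traceLeft, Matrix.diag_apply, Matrix.of_apply, Fintype.sum_prod_type]
  exact Finset.sum_comm

/-- A density matrix with `ρ² = μ ρ` has all its nonzero eigenvalues equal to `μ`. -/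
theorem entropy_of_mul_self {X : Type} [Fintype X] [DecidableEq X] {ρ : Matrix X X ℂ}
    (hρ : ρ.IsHermitian) {μ : ℝ} (h : ρ * ρ = (μ : ℂ) • ρ) (ht : ρ.trace = 1) :
    μ ≠ 0 ∧ entropy hρ = -Real.logb 2 μ := by
  have hsum : ∑ i, hρ.eigenvalues i = 1 := by
    have := hρ.trace_eq_sum_eigenvalues
    rw [ht] at this
    exact Complex.ofReal_injective (by rw [Complex.ofReal_sum]; exact this.symm)
  have hev : ∀ i, hρ.eigenvalues i = 0 ∨ hρ.eigenvalues i = μ := by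
    intro i
    have h1 := hρ.mulVec_eigenvectorBasis i
    have hne : (hρ.eigenvectorBasis i).ofLp ≠ 0 := by
      have := hρ.eigenvectorBasis.orthonormal.ne_zero i
      simpa using this
    set v := (hρ.eigenvectorBasis i).ofLp
    have h2 : (ρ * ρ) *ᵥ v = (hρ.eigenvalues i * hρ.eigenvalues i) • v := by
      rw [← Matrix.mulVec_mulVec, h1, Matrix.mulVec_smul, h1, smul_smul]
    have h3 : (ρ * ρ) *ᵥ v = (μ * hρ.eigenvalues i) • v := by
      rw [h, Matrix.smul_mulVec, h1, mul_smul, Complex.coe_smul]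
    have h4 := smul_left_injective ℝ hne (h2.symm.trans h3)
    rcases eq_or_ne (hρ.eigenvalues i) 0 with h0 | h0
    · exact Or.inl h0
    · exact Or.inr (mul_right_cancel₀ h0 h4)
  constructor
  -- if `μ = 0`, all eigenvalues vanish, against the normalization of the trace
  · rintro rfl
    simp only [or_self] at hev
    simp [hev] at hsum
  · rw [entropy]
    have : ∀ i, hρ.eigenvalues i * Real.logb 2 (hρ.eigenvalues i)
        = hρ.eigenvalues i * Real.logb 2 μ := fun i => by
      rcases hev i with h | h <;> simp [h]
    simp only [this, ← Finset.sum_mul, hsum, one_mul]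

/-! ### Twirling over the Pauli operators on a subsystem -/

section twirl

variable {n : ℕ}

/-- The Pauli strings supported on `A`. -/
def stringsOn (A : Finset (Fin n)) : Finset (PauliString n) :=
  Fintype.piFinset fun i => if i ∈ A then Finset.univ else {Pauli.I}

theorem mem_stringsOn {A : Finset (Fin n)} {p : PauliString n} :
    p ∈ stringsOn A ↔ p.SupportedOn A := by
  simp only [stringsOn, Fintype.mem_piFinset, PauliString.SupportedOn]
  refine forall_congr' fun i => ?_
  by_cases h : i ∈ A <;> simp [h]

theorem mul_mem_stringsOn {A : Finset (Fin n)} {p q : PauliString n} (hp : p ∈ stringsOn A)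
    (hq : q ∈ stringsOn A) : p * q ∈ stringsOn A := by
  rw [mem_stringsOn] at *
  intro i hi
  rw [Pi.mul_apply, hp i hi, hq i hi]
  rfl

/-- The sum of the conjugates of `M` by all Pauli strings supported on `A`. -/
noncomputable def twirl (A : Finset (Fin n)) (M : Operator n) : Operator n :=
  ∑ p ∈ stringsOn A, p.toOperator * M * p.toOperator

/-- The sum factorizes over the sites: on `A` it is the full sum over the Pauli labels, and outside
of `A` only the identity contributes. -/
theorem sum_stringsOn (A : Finset (Fin n)) (x u v y : Qubits (Fin n)) :
    ∑ p ∈ stringsOn A, p.toOperator x u * p.toOperator v y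
      = ∏ i, if i ∈ A then 2 * ((if x i = y i then 1 else 0) * if u i = v i then 1 else 0)
          else ((if x i = u i then 1 else 0) * if v i = y i then 1 else 0 : ℂ) := by
  have h : ∀ i, ∑ p ∈ (if i ∈ A then Finset.univ else {Pauli.I}),
      p.toMatrix (x i) (u i) * p.toMatrix (v i) (y i)
      = if i ∈ A then 2 * ((if x i = y i then 1 else 0) * if u i = v i then 1 else 0)
          else ((if x i = u i then 1 else 0) * if v i = y i then 1 else 0 : ℂ) := fun i => by
    by_cases hi : i ∈ A
    · simp only [hi, if_true]
      exact Pauli.sum_toMatrix_mul _ _ _ _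
    · simp [hi, Pauli.toMatrix, Matrix.one_apply]
  rw [← Finset.prod_congr rfl fun i _ => h i, Finset.prod_univ_sum]
  simp only [stringsOn, PauliString.toOperator, Matrix.of_apply, Finset.prod_mul_distrib]

/-- Twirling over the Pauli operators on `A` replaces the state of `A` by the maximally mixed one. -/
theorem reindex_twirl (A : Finset (Fin n)) (M : Operator n) :
    Matrix.reindex (splitAB A) (splitAB A) (twirl A M)
      = (2 ^ A.card : ℂ) • (1 ⊗ₖ traceLeft (Matrix.reindex (splitAB A) (splitAB A) M)) := by
  ext ⟨a, b⟩ ⟨a', b'⟩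
  set e := splitAB A with he
  have hA : ∀ a b (i : Fin n) (hi : i ∈ A), e.symm (a, b) i = a ⟨i, hi⟩ := fun a b i hi => by
    simp [he, splitAB, Equiv.piEquivPiSubtypeProd, hi]
  have hB : ∀ a b (i : Fin n) (hi : i ∉ A), e.symm (a, b) i = b ⟨i, hi⟩ := fun a b i hi => by
    simp [he, splitAB, Equiv.piEquivPiSubtypeProd, hi]
  have key : ∀ a b a₁ b₁ a₂ b₂ a' b',
      ∑ p ∈ stringsOn A, p.toOperator (e.symm (a, b)) (e.symm (a₁, b₁)) *
        p.toOperator (e.symm (a₂, b₂)) (e.symm (a', b'))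
      = (2 ^ A.card : ℂ) * (if a = a' then 1 else 0) *
        ((if a₁ = a₂ then 1 else 0) * (if b = b₁ then 1 else 0) * if b₂ = b' then 1 else 0) := by
    intro a b a₁ b₁ a₂ b₂ a' b'
    rw [sum_stringsOn, ← Fintype.prod_subtype_mul_prod_subtype (fun i => i ∈ A)]
    have h1 : ∀ i : {i // i ∈ A}, (if (i : Fin n) ∈ A then
        2 * ((if e.symm (a, b) i = e.symm (a', b') i then 1 else 0) *
          if e.symm (a₁, b₁) i = e.symm (a₂, b₂) i then 1 else 0)
        else ((if e.symm (a, b) i = e.symm (a₁, b₁) i then 1 else 0) *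
          if e.symm (a₂, b₂) i = e.symm (a', b') i then 1 else 0 : ℂ))
        = 2 * ((if a i = a' i then 1 else 0) * if a₁ i = a₂ i then 1 else 0) := fun i => by
      rw [if_pos i.2, hA _ _ _ i.2, hA _ _ _ i.2, hA _ _ _ i.2, hA _ _ _ i.2]
    have h2 : ∀ i : {i // i ∉ A}, (if (i : Fin n) ∈ A then
        2 * ((if e.symm (a, b) i = e.symm (a', b') i then 1 else 0) *
          if e.symm (a₁, b₁) i = e.symm (a₂, b₂) i then 1 else 0)
        else ((if e.symm (a, b) i = e.symm (a₁, b₁) i then 1 else 0) *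
          if e.symm (a₂, b₂) i = e.symm (a', b') i then 1 else 0 : ℂ))
        = (if b i = b₁ i then 1 else 0) * if b₂ i = b' i then 1 else 0 := fun i => by
      rw [if_neg i.2, hB _ _ _ i.2, hB _ _ _ i.2, hB _ _ _ i.2, hB _ _ _ i.2]
    simp only [h1, h2, Finset.prod_mul_distrib, Finset.prod_ite_zero, Finset.prod_const_one,
      Finset.prod_const, Finset.card_univ, Fintype.card_coe, Finset.mem_univ, true_imp_iff,
      funext_iff]
    ring
  have entry : twirl A M (e.symm (a, b)) (e.symm (a', b'))
      = ∑ v, ∑ u, M (e.symm u) (e.symm v) * ∑ p ∈ stringsOn A,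
        p.toOperator (e.symm (a, b)) (e.symm u) * p.toOperator (e.symm v) (e.symm (a', b')) := by
    simp only [twirl, Matrix.sum_apply, Matrix.mul_apply, Finset.mul_sum, Finset.sum_mul]
    rw [Finset.sum_comm, ← Equiv.sum_comp e.symm]
    refine Finset.sum_congr rfl fun v _ => ?_
    rw [Finset.sum_comm, ← Equiv.sum_comp e.symm]
    refine Finset.sum_congr rfl fun u _ => Finset.sum_congr rfl fun p _ => ?_
    ring
  simp only [Matrix.reindex_apply, Matrix.submatrix_apply, Matrix.smul_apply,
    Matrix.kroneckerMap_apply, traceLeft, Matrix.of_apply, entry, Fintype.sum_prod_type, key,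
    Matrix.one_apply, smul_eq_mul]
  by_cases h : a = a'
  · simp [h, Finset.mul_sum, mul_comm]
  · simp [h]

end twirl

/-- If twirling `M` over `A` gives an operator proportional to its square, then so does tracing
out `A`. -/
theorem traceLeft_mul_self {n : ℕ} {A : Finset (Fin n)} {M : Operator n} {l : ℝ}
    (h : twirl A M * twirl A M = (l : ℂ) • twirl A M) :
    traceLeft (Matrix.reindex (splitAB A) (splitAB A) M) *
      traceLeft (Matrix.reindex (splitAB A) (splitAB A) M)
      = ((l / 2 ^ A.card : ℝ) : ℂ) • traceLeft (Matrix.reindex (splitAB A) (splitAB A) M) := by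
  set e := splitAB A
  have h1 := congrArg (Matrix.reindexAlgEquiv ℂ ℂ e) h
  rw [map_mul, map_smul, Matrix.coe_reindexAlgEquiv, reindex_twirl, smul_mul_smul_comm,
    ← Matrix.mul_kronecker_mul, smul_smul, one_mul] at h1
  set R := traceLeft (Matrix.reindex e e M)
  have h2 : (2 ^ A.card : ℂ) ≠ 0 := pow_ne_zero _ two_ne_zero
  -- the factor `1` on `A` is removed by looking at one of its diagonal entries
  ext b b'
  have h3 := congrFun (congrFun h1 (0, b)) (0, b')
  simp only [Matrix.smul_apply, Matrix.kroneckerMap_apply, Matrix.one_apply_eq, one_mul,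
    smul_eq_mul] at h3 ⊢
  push_cast
  rw [div_mul_eq_mul_div, eq_div_iff h2]
  refine mul_right_cancel₀ h2 ?_
  linear_combination h3

/-- The square of the twirl of a record operator: among the cross terms between conjugates by `p`
and `q` only those survive for which the codeword of `p q` is an error. -/
theorem twirl_mul_self {n τ : ℕ} {P : Fin τ → Operator n} (hP : ∀ j, IsPauli (P j))
    (A : Finset (Fin n)) {M : Operator n} {l : ℝ} (hl : M * M = (l : ℂ) • M)
    (hM : ∀ Q, IsPauli Q → (seqCodeword P Q ∈ seqErrorGroup P → Commute Q M) ∧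
      (seqCodeword P Q ∉ seqErrorGroup P → M * Q * M = 0)) :
    twirl A M * twirl A M = ((l * ({p : PauliString n | p.SupportedOn A ∧
      seqCodeword P p.toOperator ∈ seqErrorGroup P}.ncard : ℝ) : ℝ) : ℂ) • twirl A M := by
  classical
  set S := (stringsOn A).filter fun p => seqCodeword P p.toOperator ∈ seqErrorGroup P with hS
  have hcard : {p : PauliString n | p.SupportedOn A ∧
      seqCodeword P p.toOperator ∈ seqErrorGroup P}.ncard = S.card := by
    rw [← Set.ncard_coe_finset]
    congr 1
    ext p
    simp [hS, mem_stringsOn]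
  have hterm : ∀ p q : PauliString n,
      p.toOperator * M * p.toOperator * (q.toOperator * M * q.toOperator)
      = if seqCodeword P (p * q).toOperator ∈ seqErrorGroup P then
        (l : ℂ) • (p.toOperator * M * p.toOperator) else 0 := by
    intro p q
    have hpq := p.isPauli.mul q.isPauli
    have hc : seqCodeword P (p.toOperator * q.toOperator) = seqCodeword P (p * q).toOperator := by
      obtain ⟨k, hk⟩ := p.toOperator_mul q
      rw [hk, seqCodeword_smul hP (p * q).isPauli]
    have e : p.toOperator * M * p.toOperator * (q.toOperator * M * q.toOperator)
        = p.toOperator * (M * (p.toOperator * q.toOperator) * M) * q.toOperator := by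
      simp only [mul_assoc]
    rw [← hc, e]
    split_ifs with h
    · have hcom := (hM _ hpq).1 h
      rw [mul_assoc M, hcom.eq, ← mul_assoc M, hl]
      simp only [Matrix.smul_mul, Matrix.mul_smul, mul_assoc, q.toOperator_mul_self, mul_one]
    · rw [(hM _ hpq).2 h, mul_zero, zero_mul]
  -- multiplication by `p` is an involution of the strings on `A`
  have hcount : ∀ p ∈ stringsOn A, ((stringsOn A).filter fun q =>
      seqCodeword P (p * q).toOperator ∈ seqErrorGroup P).card = S.card := by
    intro p hp
    have hpp : ∀ q : PauliString n, p * (p * q) = q := fun q =>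
      funext fun i => Pauli.mul_mul_cancel _ _
    refine Finset.card_bij' (fun q _ => p * q) (fun q _ => p * q) ?_ ?_ (fun q _ => hpp q)
      (fun q _ => hpp q)
    · intro q hq
      rw [Finset.mem_filter] at hq
      exact Finset.mem_filter.mpr ⟨mul_mem_stringsOn hp hq.1, hq.2⟩
    · intro q hq
      rw [Finset.mem_filter] at hq
      exact Finset.mem_filter.mpr ⟨mul_mem_stringsOn hp hq.1, by rw [hpp]; exact hq.2⟩
  rw [hcard]
  conv_lhs => rw [twirl, Finset.sum_mul_sum]
  rw [twirl, Finset.smul_sum]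
  refine Finset.sum_congr rfl fun p hp => ?_
  simp only [hterm]
  rw [← Finset.sum_filter, Finset.sum_const, hcount p hp, ← Nat.cast_smul_eq_nsmul ℂ, smul_smul]
  push_cast
  rw [mul_comm]

theorem twirl_smul {n : ℕ} (A : Finset (Fin n)) (a : ℂ) (M : Operator n) :
    twirl A (a • M) = a • twirl A M := by
  simp [twirl, Finset.smul_sum]

theorem Circuit.condEntropy_eq {n τ : ℕ} (c : Circuit n τ) (A : Finset (Fin n))
    {m : Fin τ → ℤˣ} (hm : c.prob m ≠ 0) :
    c.condEntropy A m = -(A.card : ℝ) + Real.logb 2 (c.numNull A : ℝ) := by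
  obtain ⟨⟨l, hl⟩, hM⟩ := projProd_spec c.P c.isPauli_P c.isHermitian_P m
    (c.kraus_mul_conjTranspose m)
  have hT := twirl_mul_self c.isPauli_P A hl hM
  have hρ := c.rhoAB_eq m
  have htr := c.trace_kraus m
  set M := c.kraus m * (c.kraus m)ᴴ
  set D : ℝ := 2 ^ n * c.prob m with hD
  have hD0 : D ≠ 0 := mul_ne_zero (by positivity) hm
  have hN : {p : PauliString n | p.SupportedOn A ∧
      seqCodeword c.P p.toOperator ∈ seqErrorGroup c.P}.ncard = c.numNull A := rfl
  rw [hN] at hT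
  have htr1 : (c.rhoAB m).trace = 1 := by
    rw [hρ, Matrix.trace_smul, htr, smul_eq_mul, ← Complex.ofReal_mul, inv_mul_cancel₀ hD0,
      Complex.ofReal_one]
  have hAB : c.rhoAB m * c.rhoAB m = ((l / D : ℝ) : ℂ) • c.rhoAB m := by
    rw [hρ, smul_mul_smul_comm, hl, smul_smul, smul_smul]
    congr 1
    push_cast
    ring
  have hT' : twirl A (c.rhoAB m) * twirl A (c.rhoAB m)
      = ((l / D * c.numNull A : ℝ) : ℂ) • twirl A (c.rhoAB m) := by
    rw [hρ, twirl_smul, smul_mul_smul_comm, hT, smul_smul, smul_smul]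
    congr 1
    push_cast
    ring
  have hB : c.rhoB A m * c.rhoB A m
      = ((l / D * c.numNull A / 2 ^ A.card : ℝ) : ℂ) • c.rhoB A m := traceLeft_mul_self hT'
  have htrB : (c.rhoB A m).trace = 1 := by
    rw [Circuit.rhoB, trace_traceLeft, ← htr1]
    exact Equiv.sum_comp (splitAB A).symm fun x => c.rhoAB m x x
  obtain ⟨h1, h2⟩ := entropy_of_mul_self (c.isHermitian_rhoAB m) hAB htr1
  obtain ⟨h3, h4⟩ := entropy_of_mul_self (c.isHermitian_rhoB A m) hB htrB
  have hN0 : (c.numNull A : ℝ) ≠ 0 := by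
    intro h
    simp [h] at h3
  rw [Circuit.condEntropy, h2, h4, Real.logb_div (mul_ne_zero h1 hN0) (by positivity),
    Real.logb_mul h1 hN0, Real.logb_pow, Real.logb_self_eq_one one_lt_two]
  ring

end MonitoredClifford

theorem theorem2 {n τ : ℕ} (c : MonitoredClifford.Circuit n τ) (A : Finset (Fin n)) :
    (∀ m : Fin τ → ℤˣ, c.prob m ≠ 0 →
      c.condEntropy A m = -(A.card : ℝ) + Real.logb 2 (c.numNull A : ℝ)) ∧
    (∀ m m' : Fin τ → ℤˣ, c.prob m ≠ 0 → c.prob m' ≠ 0 →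
      c.condEntropy A m = c.condEntropy A m') :=
  ⟨fun _ hm => c.condEntropy_eq A hm,
    fun _ _ hm hm' => (c.condEntropy_eq A hm).trans (c.condEntropy_eq A hm').symm⟩
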